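/- Let $F$ be a finite field with $F\neq\mathbb F_2$ and let $V$ be a finite-dimensional vector space over $F$. Let $\varphi$ be one of the following forms on $V$, and let $n$ be its Witt index, that is, the largest dimension of a totally isotropic subspace of $V$ (for a quadratic form: of a subspace on which the form vanishes identically): 1. a non-degenerate alternating bilinear form, with $n\ge 2$; 2. a non-degenerate quadratic form, with $n\ge 3$ (in any characteristic; non-degenerate means that no non-zero vector of the radical of the polar bilinear form is singular); 3. a non-degenerate hermitian form with respect to an automorphism of $F$ of order $2$, with $n\ge 3$. Let $\Omega\subseteq\mathrm{PG}(\bigwedge^2V)$ be the set of the points $[v_1\wedge v_2]$, where $\langle v_1,v_2\rangle$ ranges over the $2$-dimensional totally isotropic subspaces of $V$. For each $\omega\in\Omega$ choose a vector $w_\omega$ representing $\omega$, and let $$\mathcal C=\{(\xi(w_\omega))_{\omega\in\Omega} : \xi\in(\textstyle\bigwedge^2V)^*\}\subseteq F^{\Omega}.$$ This is the line symplectic, line orthogonal or line hermitian Grassmann code, in cases 1, 2 and 3 respectively. Then $\mathcal C$ is a minimal code: if $c,c'\in\mathcal C$ and $\mathrm{supp}(c')\subseteq\mathrm{supp}(c)$,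 then $c'=\lambda c$ for some $\lambda\in F$. -/

import Mathlib

open scoped LinearAlgebra.Projectivization

noncomputable section

/-! ### Linear codes and minimality -/

/-- A codeword `c` of the linear code `C` is minimal if every codeword of `C` whose support is
contained in the support of `c` is a scalar multiple of `c`. -/
def IsMinimalCodeword {F ι : Type*} [Field F] (C : Submodule F (ι → F)) (c : ι → F) : Prop :=
  ∀ c' ∈ C, Function.support c' ⊆ Function.support c → ∃ a : F, c' = a • c

/-- A linear code is minimal if all its codewords are minimal. -/
def IsMinimalCode {F ι : Type*} [Field F] (C : Submodule F (ι → F)) : Prop :=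
  ∀ c ∈ C, IsMinimalCodeword C c

/-! ### The code of a projective system -/

/-- The linear code of a set `Ω` of points of the projective space `PG(W)`. Its positions are the
points of `Ω`, and its codewords are the words `(ξ(w_ω))_ω`, where `w_ω` is a representative vector
of `ω` and `ξ` is a linear form. This is the row space of a matrix whose columns are coordinates of
the `w_ω`; as every linear form on `⟨Ω⟩` extends to `W`, it does not matter whether the coordinates
are taken in `W` or in `⟨Ω⟩`. -/
def projectiveCode {F W : Type*} [Field F] [AddCommGroup W] [Module F W] (Ω : Set (ℙ F W)) :
    Submodule F (Ω → F) :=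
  LinearMap.range
    (LinearMap.pi (fun ω : Ω => LinearMap.applyₗ (ω : ℙ F W).rep) :
      Module.Dual F W →ₗ[F] (Ω → F))

/-! ### The Grassmann (Plücker) embedding -/

/-- The image under the Grassmann embedding `⟨v₁, …, v_k⟩ ↦ [v₁ ∧ ⋯ ∧ v_k]` of the set of all
`k`-dimensional subspaces that belong to the family `S`. -/
def grassmannImage {F V : Type*} [Field F] [AddCommGroup V] [Module F V] (k : ℕ)
    (S : Set (Submodule F V)) : Set (ℙ F (⋀[F]^k V)) :=
  {P | ∃ v : Fin k → V, LinearIndependent F v ∧ Submodule.span F (Set.range v) ∈ S ∧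
    P.submodule = Submodule.span F {exteriorPower.ιMulti F k v}}

/-! ### Totally isotropic subspaces, polar Grassmann codes -/

/-- The subspaces that are totally isotropic for a reflexive sesquilinear (for instance an
alternating or a hermitian) form. -/
def totallyIsotropic {F V : Type*} [Field F] [AddCommGroup V] [Module F V] {σ : F →+* F}
    (φ : V →ₛₗ[σ] V →ₗ[F] F) : Set (Submodule F V) :=
  {X | ∀ x ∈ X, ∀ y ∈ X, φ x y = 0}

/-- The subspaces on which a quadratic form vanishes identically. -/
def totallySingular {F V : Type*} [Field F] [AddCommGroup V] [Module F V]
    (Q : QuadraticForm F V) : Set (Submodule F V) :=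
  {X | ∀ x ∈ X, Q x = 0}

/-- The Witt index: the largest dimension of a member of the family `S` of totally isotropic
subspaces of a finite-dimensional space. -/
def wittIndex {F V : Type*} [Field F] [AddCommGroup V] [Module F V]
    (S : Set (Submodule F V)) : ℕ :=
  sSup ((fun X : Submodule F V => Module.finrank F X) '' S)

/-- The polar `k`-Grassmann code of the polar space with family `S` of totally isotropic subspaces:
the code of the image of the totally isotropic `k`-dimensional subspaces in `PG(⋀^k V)`. -/
def polarGrassmannCode {F V : Type*} [Field F] [AddCommGroup V] [Module F V] (k : ℕ)
    (S : Set (Submodule F V)) : Submodule F (grassmannImage k S → F) :=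
  projectiveCode (grassmannImage k S)

end

/-! A linear form on `⋀² V` is an alternating form on V, and its codeword records the values on
totally singular lines. So let A, B be alternating, with B vanishing on each totally singular line
where A does; the claim is B = cA on these lines. Fix a singular p. The lines through p form a
smaller polar space, modelled on {p,q}^⊥ with q singular and not orthogonal to p. Off a hyperplane a
polar space is connected by lines, so B(p,·) = c(p) A(p,·) on p^⊥ (`mul_eq_mul_of_ker_le`).
Alternation gives c(p) = c(w) for orthogonal p, w with A(p,w) ≠ 0. As a polar space is not a union
of two proper hyperplanes (`exists_ne_zero_and_ne_zero`), such steps join all points where A(p,·) is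
not zero on the lines through p, so c is constant (`exists_eq_mul`). Rank 3 leaves rank 2 in
{p,q}^⊥, enough for connectedness; in the symplectic case all vectors are singular and every
projective line can be used. -/

/-! ### Abstract polar spaces -/

/-- The set `S` behaves like the set of singular vectors of a form whose associated sesquilinear
form is `φ`, and no nonzero vector of `S` lies in the radical of `φ`. -/
structure IsPolarSpace {F V : Type*} [Field F] [AddCommGroup V] [Module F V] {σ : F →+* F}
    (φ : V →ₛₗ[σ] V →ₗ[F] F) (S : Set V) : Prop where
  smul_mem : ∀ (a : F) {x}, x ∈ S → a • x ∈ S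
  add_mem : ∀ {x y}, x ∈ S → y ∈ S → φ x y = 0 → x + y ∈ S
  symm : ∀ {x y}, φ x y = 0 → φ y x = 0
  self : ∀ {x}, x ∈ S → φ x x = 0
  exists_add_smul_mem : ∀ {x w}, x ∈ S → φ x w ≠ 0 → ∃ c : F, w + c • x ∈ S
  exists_ne : ∀ {x}, x ∈ S → x ≠ 0 → ∃ w, φ x w ≠ 0

section PolarSpace

variable {F V : Type*} [Field F] [AddCommGroup V] [Module F V] {σ : F →+* F}

/-- The vectors orthogonal to both `x` and `y`. -/
def perpPair (φ : V →ₛₗ[σ] V →ₗ[F] F) (x y : V) : Submodule F V :=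
  LinearMap.ker (φ x) ⊓ LinearMap.ker (φ y)

theorem mem_perpPair {φ : V →ₛₗ[σ] V →ₗ[F] F} {x y w : V} :
    w ∈ perpPair φ x y ↔ φ x w = 0 ∧ φ y w = 0 := by
  simp [perpPair]

/-- Every nonzero vector of `S` in `U` is non-orthogonal to another vector of `S` in `U`. -/
def IsSeparating (φ : V →ₛₗ[σ] V →ₗ[F] F) (S : Set V) (U : Submodule F V) : Prop :=
  ∀ x ∈ S, x ∈ U → x ≠ 0 → ∃ w ∈ S, w ∈ U ∧ φ x w ≠ 0

/-- Any two non-orthogonal vectors of `S` in `U` either span a subspace contained in `S` or have a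
nonzero common orthogonal vector of `S` in `U`. -/
def HasCommonPerp (φ : V →ₛₗ[σ] V →ₗ[F] F) (S : Set V) (U : Submodule F V) : Prop :=
  ∀ y ∈ S, y ∈ U → ∀ z ∈ S, z ∈ U → φ y z ≠ 0 →
    (∀ c : F, y + c • z ∈ S) ∨ ∃ u ∈ S, u ∈ U ⊓ perpPair φ y z ∧ u ≠ 0

/-- There is a subspace of `U` of dimension at least `k` that is contained in `S` and on which `φ`
vanishes. -/
def HasIsotropic (φ : V →ₛₗ[σ] V →ₗ[F] F) (S : Set V) (U : Submodule F V) (k : ℕ) : Prop :=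
  ∃ X ≤ U, (∀ x ∈ X, x ∈ S) ∧ (∀ x ∈ X, ∀ y ∈ X, φ x y = 0) ∧ k ≤ Module.finrank F X

theorem finrank_le_finrank_inf_ker_add_one [FiniteDimensional F V] (X : Submodule F V)
    (f : V →ₗ[F] F) :
    Module.finrank F X ≤ Module.finrank F (X ⊓ LinearMap.ker f : Submodule F V) + 1 := by
  have h1 := Submodule.finrank_sup_add_finrank_inf_eq X (LinearMap.ker f)
  have h2 := Submodule.finrank_le (X ⊔ LinearMap.ker f)
  have h3 := f.finrank_range_add_finrank_ker
  have h4 : Module.finrank F (LinearMap.range f) ≤ 1 := by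
    simpa using Submodule.finrank_le (LinearMap.range f)
  omega

/-! ### Passing to the perp of a hyperbolic pair -/

namespace IsPolarSpace

variable {φ : V →ₛₗ[σ] V →ₗ[F] F} {S : Set V}

theorem ne_symm (h : IsPolarSpace φ S) {x y : V} (hxy : φ x y ≠ 0) : φ y x ≠ 0 :=
  fun h0 => hxy (h.symm h0)

theorem add_smul_mem (h : IsPolarSpace φ S) {x y : V} (hx : x ∈ S) (hy : y ∈ S)
    (hxy : φ x y = 0) (c : F) : x + c • y ∈ S :=
  h.add_mem hx (h.smul_mem c hy) (by simp [hxy])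

theorem isSeparating_top (h : IsPolarSpace φ S) : IsSeparating φ S ⊤ := by
  intro x hx _ hx0
  obtain ⟨w, hw⟩ := h.exists_ne hx hx0
  obtain ⟨c, hc⟩ := h.exists_add_smul_mem hx hw
  exact ⟨_, hc, trivial, by simpa [h.self hx] using hw⟩

/-- Projecting `w` away from `y` and `z` keeps `φ x w`, since `x` is orthogonal to both; a multiple
of `x` then makes the result singular. -/
theorem isSeparating_inf_perpPair (h : IsPolarSpace φ S) {U : Submodule F V}
    (hU : IsSeparating φ S U) {y z : V} (hy : y ∈ S) (hyU : y ∈ U) (hz : z ∈ S) (hzU : z ∈ U)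
    (hyz : φ y z ≠ 0) : IsSeparating φ S (U ⊓ perpPair φ y z) := by
  rintro x hx ⟨hxU, hxp⟩ hx0
  rw [SetLike.mem_coe, mem_perpPair] at hxp
  obtain ⟨w, -, hwU, hw⟩ := hU x hx hxU hx0
  have hzy := h.ne_symm hyz
  set w' := w - (φ z w / φ z y) • y - (φ y w / φ y z) • z with hw'
  have hxw : φ x w' ≠ 0 := by simpa [hw', h.symm hxp.1, h.symm hxp.2] using hw
  obtain ⟨c, hc⟩ := h.exists_add_smul_mem hx hxw
  refine ⟨_, hc, ⟨?_, ?_⟩, by simpa [h.self hx] using hxw⟩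
  · exact U.add_mem (U.sub_mem (U.sub_mem hwU (U.smul_mem _ hyU)) (U.smul_mem _ hzU))
      (U.smul_mem _ hxU)
  · rw [SetLike.mem_coe, mem_perpPair]
    constructor <;> simp [hw', hxp.1, hxp.2, h.self hy, h.self hz, hyz, hzy]

/-- Only one dimension is lost: X can be replaced by (X ∩ y^⊥) + ⟨y⟩, which already lies in y^⊥, and
only z^⊥ remains to be cut. -/
theorem hasIsotropic_inf_perpPair [FiniteDimensional F V] (h : IsPolarSpace φ S)
    {U : Submodule F V} {k : ℕ} (hU : HasIsotropic φ S U (k + 1)) {y z : V} (hy : y ∈ S)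
    (hyU : y ∈ U) (hyz : φ y z ≠ 0) : HasIsotropic φ S (U ⊓ perpPair φ y z) k := by
  have key : ∃ X ≤ U, (∀ x ∈ X, x ∈ S) ∧ (∀ x ∈ X, ∀ y ∈ X, φ x y = 0) ∧
      k + 1 ≤ Module.finrank F X ∧ y ∈ X := by
    obtain ⟨X, hXU, hXS, hXp, hXk⟩ := hU
    by_cases hyX : y ∈ X
    · exact ⟨X, hXU, hXS, hXp, hXk, hyX⟩
    refine ⟨(X ⊓ LinearMap.ker (φ y)) ⊔ Submodule.span F {y}, ?_, ?_, ?_, ?_, ?_⟩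
    · refine sup_le (inf_le_left.trans hXU) ?_
      simpa using hyU
    · intro x hx
      obtain ⟨a, ⟨haX, hay⟩, b, hb, rfl⟩ := Submodule.mem_sup.1 hx
      obtain ⟨c, rfl⟩ := Submodule.mem_span_singleton.1 hb
      exact h.add_smul_mem (hXS a haX) hy (h.symm hay) c
    · intro x hx x' hx'
      obtain ⟨a, ⟨haX, hay⟩, b, hb, rfl⟩ := Submodule.mem_sup.1 hx
      obtain ⟨c, rfl⟩ := Submodule.mem_span_singleton.1 hb
      obtain ⟨a', ⟨haX', hay'⟩, b', hb', rfl⟩ := Submodule.mem_sup.1 hx'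
      obtain ⟨c', rfl⟩ := Submodule.mem_span_singleton.1 hb'
      rw [SetLike.mem_coe, LinearMap.mem_ker] at hay hay'
      simp [hXp a haX a' haX', h.symm hay, hay', h.self hy]
    · have h1 := finrank_le_finrank_inf_ker_add_one X (φ y)
      have h2 := Submodule.finrank_sup_add_finrank_inf_eq (X ⊓ LinearMap.ker (φ y))
        (Submodule.span F {y})
      have hy0 : y ≠ 0 := by
        rintro rfl
        simp at hyz
      have h3 : (X ⊓ LinearMap.ker (φ y)) ⊓ Submodule.span F {y} = ⊥ :=
        ((Submodule.disjoint_span_singleton' hy0).2 fun hm => hyX (Submodule.mem_inf.1 hm).1).eq_bot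
      rw [h3, finrank_bot, finrank_span_singleton hy0] at h2
      omega
    · exact Submodule.mem_sup_right (Submodule.mem_span_singleton_self y)
  obtain ⟨X, hXU, hXS, hXp, hXk, hyX⟩ := key
  refine ⟨X ⊓ LinearMap.ker (φ z), ?_, fun x hx => hXS x hx.1,
    fun x hx x' hx' => hXp x hx.1 x' hx'.1, ?_⟩
  · exact fun x hx => ⟨hXU hx.1, mem_perpPair.2 ⟨hXp y hyX x hx.1, hx.2⟩⟩
  · have := finrank_le_finrank_inf_ker_add_one X (φ z)
    omega

theorem hasCommonPerp_of_hasIsotropic [FiniteDimensional F V] (h : IsPolarSpace φ S)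
    {U : Submodule F V} (hU : HasIsotropic φ S U 2) : HasCommonPerp φ S U := by
  intro y hy hyU z hz hzU hyz
  obtain ⟨X, hXU, hXS, -, hXk⟩ := h.hasIsotropic_inf_perpPair hU hy hyU hyz
  have hX : X ≠ ⊥ := by
    rintro rfl
    simp at hXk
  obtain ⟨u, hu, hu0⟩ := X.exists_mem_ne_zero_of_ne_bot hX
  exact Or.inr ⟨u, hXS u hu, hXU hu, hu0⟩

/-! ### Linear forms on a polar space -/

/-- If `y` and `z` are not orthogonal, then the lines `⟨y, u⟩` and `⟨z, u'⟩` contain orthogonal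
points `y + u` and `z + b u'` whenever `u`, `u'` are non-orthogonal vectors orthogonal to `y` and
`z`. -/
theorem apply_add_add_smul (h : IsPolarSpace φ S) {y z u u' : V} (hu : u ∈ perpPair φ y z)
    (hu' : u' ∈ perpPair φ y z) (huu : φ u u' ≠ 0) :
    φ (y + u) (z + (-(φ y z / φ u u')) • u') = 0 := by
  rw [mem_perpPair] at hu hu'
  simp [hu'.1, h.symm hu.2, huu]

/-- The complement of a hyperplane in a polar space is connected: a linear form vanishing on the
singular vectors of a hyperplane is proportional to the equation of this hyperplane. -/
theorem mul_eq_mul_of_ker_le (h : IsPolarSpace φ S) {U : Submodule F V} (hs : IsSeparating φ S U)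
    (hc : HasCommonPerp φ S U) {f g : V →ₗ[F] F} (hfg : ∀ y ∈ S, y ∈ U → f y = 0 → g y = 0)
    {y z : V} (hy : y ∈ S) (hyU : y ∈ U) (hz : z ∈ S) (hzU : z ∈ U) :
    g y * f z = g z * f y := by
  have line : ∀ {y z : V}, y ∈ U → z ∈ S → z ∈ U → (∀ c : F, y + c • z ∈ S) →
      g y * f z = g z * f y := by
    intro y z hyU hz hzU hyz
    by_cases hf : f z = 0
    · simp [hf, hfg z hz hzU hf]
    -- This is the point of the line where `f` vanishes.
    have := hfg _ (hyz (-(f y / f z))) (U.add_mem hyU (U.smul_mem _ hzU)) (by simp [hf])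
    simp only [map_add, map_smul, smul_eq_mul] at this
    field_simp at this
    linear_combination this
  have trans : ∀ {a b c : V}, f b ≠ 0 → g a * f b = g b * f a → g b * f c = g c * f b →
      g a * f c = g c * f a := by
    intro a b c hb h1 h2
    apply mul_right_cancel₀ hb
    linear_combination f c * h1 + f a * h2
  have perp : ∀ {y z : V}, y ∈ S → y ∈ U → z ∈ S → z ∈ U → φ y z = 0 →
      g y * f z = g z * f y :=
    fun hy hyU hz hzU hyz => line hyU hz hzU (h.add_smul_mem hy hz hyz)
  by_cases hyz : φ y z = 0
  · exact perp hy hyU hz hzU hyz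
  by_cases hfy : f y = 0
  · simp [hfy, hfg y hy hyU hfy]
  by_cases hfz : f z = 0
  · simp [hfz, hfg z hz hzU hfz]
  obtain hl | ⟨u, hu, huU, hu0⟩ := hc y hy hyU z hz hzU hyz
  · exact line hyU hz hzU hl
  obtain ⟨u', hu', huU', huu⟩ :=
    h.isSeparating_inf_perpPair hs hy hyU hz hzU hyz u hu huU hu0
  have through : ∀ {v : V}, v ∈ S → v ∈ U ⊓ perpPair φ y z → f v ≠ 0 →
      g y * f z = g z * f y := by
    rintro v hv ⟨hvU, hvp⟩ hfv
    rw [SetLike.mem_coe, mem_perpPair] at hvp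
    exact trans hfv (perp hy hyU hv hvU hvp.1) (perp hv hvU hz hzU (h.symm hvp.2))
  by_cases hfu : f u = 0
  swap
  · exact through hu huU hfu
  by_cases hfu' : f u' = 0
  swap
  · exact through hu' huU' hfu'
  have hup := mem_perpPair.1 huU.2
  have hup' := mem_perpPair.1 huU'.2
  -- As `f` kills `u` and `u'`, the path y, y + u, z + b u', z of successively orthogonal vectors
  -- avoids the hyperplane.
  have hort := h.apply_add_add_smul huU.2 huU'.2 huu
  set b := -(φ y z / φ u u')
  have hyu : y + u ∈ S := h.add_mem hy hu hup.1
  have hzu : z + b • u' ∈ S := h.add_smul_mem hz hu' hup'.2 b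
  have hyuU : y + u ∈ U := U.add_mem hyU huU.1
  have hzuU : z + b • u' ∈ U := U.add_mem hzU (U.smul_mem _ huU'.1)
  refine trans (b := y + u) (by simpa [hfu] using hfy)
    (perp hy hyU hyu hyuU (by simp [h.self hy, hup.1])) ?_
  refine trans (b := z + b • u') (by simpa [hfu'] using hfz)
    (perp hyu hyuU hzu hzuU hort)
    (perp hzu hzuU hz hzU (h.symm (by simp [h.self hz, hup'.2])))

/-- A polar space is not the union of two proper hyperplanes. -/
theorem exists_ne_zero_and_ne_zero (h : IsPolarSpace φ S) {U : Submodule F V}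
    (hs : IsSeparating φ S U) (hc : HasCommonPerp φ S U) {f g : V →ₗ[F] F}
    {y z : V} (hy : y ∈ S) (hyU : y ∈ U) (hfy : f y ≠ 0)
    (hz : z ∈ S) (hzU : z ∈ U) (hgz : g z ≠ 0) :
    ∃ w ∈ S, w ∈ U ∧ f w ≠ 0 ∧ g w ≠ 0 := by
  have line : ∀ {y z : V}, y ∈ S → y ∈ U → z ∈ S → z ∈ U → y + z ∈ S → f y ≠ 0 → g z ≠ 0 →
      ∃ w ∈ S, w ∈ U ∧ f w ≠ 0 ∧ g w ≠ 0 := by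
    intro y z hy hyU hz hzU hyz hfy hgz
    by_cases hfz : f z = 0
    swap
    · exact ⟨z, hz, hzU, hfz, hgz⟩
    by_cases hgy : g y = 0
    swap
    · exact ⟨y, hy, hyU, hfy, hgy⟩
    exact ⟨y + z, hyz, U.add_mem hyU hzU, by simpa [hfz], by simpa [hgy]⟩
  by_cases hyz : φ y z = 0
  · exact line hy hyU hz hzU (h.add_mem hy hz hyz) hfy hgz
  obtain hl | ⟨u, hu, huU, hu0⟩ := hc y hy hyU z hz hzU hyz
  · exact line hy hyU hz hzU (by simpa using hl 1) hfy hgz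
  obtain ⟨u', hu', huU', huu⟩ :=
    h.isSeparating_inf_perpPair hs hy hyU hz hzU hyz u hu huU hu0
  have hup := mem_perpPair.1 huU.2
  have hup' := mem_perpPair.1 huU'.2
  by_cases hfu : f u = 0
  swap
  · exact line hu huU.1 hz hzU (h.add_mem hu hz (h.symm hup.2)) hfu hgz
  by_cases hgu : g u' = 0
  swap
  · exact line hy hyU hu' huU'.1 (h.add_mem hy hu' hup'.1) hfy hgu
  -- Moving `y` by `u` keeps `f`, and moving `z` by a multiple of `u'` keeps `g`, so the orthogonal
  -- case applies.
  have hort := h.apply_add_add_smul huU.2 huU'.2 huu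
  have hyu : y + u ∈ S := h.add_mem hy hu hup.1
  have hzu := h.add_smul_mem hz hu' hup'.2 (-(φ y z / φ u u'))
  exact line hyu (U.add_mem hyU huU.1) hzu (U.add_mem hzU (U.smul_mem _ huU'.1))
    (h.add_mem hyu hzu hort) (by simpa [hfu]) (by simpa [hgu])

/-! ### Alternating forms on the totally singular lines -/

/-- This represents p^⊥/⟨p⟩ inside {p,q}^⊥; the shift by a multiple of `p` does not change A(p,·)
for alternating A. -/
theorem sub_smul_mem_perpPair (h : IsPolarSpace φ S) {p q y : V} (hp : p ∈ S) (hpq : φ p q ≠ 0)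
    (hpy : φ p y = 0) : y - (φ q y / φ q p) • p ∈ perpPair φ p q := by
  rw [mem_perpPair]
  simp [hpy, h.self hp, h.ne_symm hpq]

theorem sub_smul_mem (h : IsPolarSpace φ S) {p y : V} (hp : p ∈ S) (hy : y ∈ S)
    (hpy : φ p y = 0) (c : F) : y - c • p ∈ S := by
  simpa [sub_eq_add_neg] using h.add_smul_mem hy hp (h.symm hpy) (-c)

/-- Two alternating forms, the second of which vanishes on the totally singular lines on which the
first one does, are proportional on the totally singular lines. -/
theorem exists_eq_mul (h : IsPolarSpace φ S)
    (hc : ∀ p ∈ S, ∀ q ∈ S, φ p q ≠ 0 → HasCommonPerp φ S (perpPair φ p q))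
    {A B : LinearMap.BilinForm F V} (hA : A.IsAlt) (hB : B.IsAlt)
    (hAB : ∀ x ∈ S, ∀ y ∈ S, φ x y = 0 → A x y = 0 → B x y = 0) :
    ∃ c : F, ∀ x ∈ S, ∀ y ∈ S, φ x y = 0 → B x y = c * A x y := by
  have hs : ∀ {p q : V}, p ∈ S → q ∈ S → φ p q ≠ 0 → IsSeparating φ S (perpPair φ p q) := by
    intro p q hp hq hpq
    simpa using h.isSeparating_inf_perpPair h.isSeparating_top hp trivial hq trivial hpq
  -- On the lines through a fixed point the two forms are proportional.
  have hloc : ∀ p : V, ∃ c : F, p ∈ S → ∀ y ∈ S, φ p y = 0 → B p y = c * A p y := by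
    intro p
    by_cases hp : p ∈ S
    swap
    · exact ⟨0, fun hp' => absurd hp' hp⟩
    by_cases hp0 : p = 0
    · exact ⟨0, by simp [hp0]⟩
    obtain ⟨q, hq, -, hpq⟩ := h.isSeparating_top p hp trivial hp0
    by_cases hz : ∃ z ∈ S, φ p z = 0 ∧ A p z ≠ 0
    swap
    · push Not at hz
      exact ⟨0, fun _ y hy hpy => by simpa using hAB p hp y hy hpy (hz y hy hpy)⟩
    obtain ⟨z, hz, hpz, hAz⟩ := hz
    refine ⟨B p z / A p z, fun _ y hy hpy => ?_⟩
    have := h.mul_eq_mul_of_ker_le (hs hp hq hpq) (hc p hp q hq hpq) (f := A p) (g := B p)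
      (fun y hy hyU => hAB p hp y hy (mem_perpPair.1 hyU).1)
      (h.sub_smul_mem hp hy hpy _) (h.sub_smul_mem_perpPair hp hpq hpy)
      (h.sub_smul_mem hp hz hpz _) (h.sub_smul_mem_perpPair hp hpq hpz)
    simp only [map_sub, map_smul, hA p, hB p, smul_zero, sub_zero] at this
    field_simp
    exact this
  choose c hcp using hloc
  have hedge : ∀ {p z : V}, p ∈ S → z ∈ S → φ p z = 0 → A p z ≠ 0 → c p = c z := by
    intro p z hp hz hpz hApz
    have h1 := hcp p hp z hz hpz
    have h2 := hcp z hz p hp (h.symm hpz)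
    rw [← hA.neg_eq p z, ← hB.neg_eq p z] at h2
    apply mul_right_cancel₀ hApz
    linear_combination -h1 - h2
  have hnonperp : ∀ {p q y z : V}, p ∈ S → q ∈ S → y ∈ S → z ∈ S → φ p q ≠ 0 →
      φ p y = 0 → A p y ≠ 0 → φ q z = 0 → A q z ≠ 0 → c p = c q := by
    intro p q y z hp hq hy hz hpq hpy hApy hqz hAqz
    have hqp := h.ne_symm hpq
    have hsw : ∀ {w : V}, w ∈ perpPair φ q p → w ∈ perpPair φ p q :=
      fun hw => mem_perpPair.2 (mem_perpPair.1 hw).symm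
    -- A common neighbour of `p` and `q` outside both hyperplanes.
    obtain ⟨w, hw, hwU, hpw, hqw⟩ := h.exists_ne_zero_and_ne_zero (hs hp hq hpq)
      (hc p hp q hq hpq) (f := A p) (g := A q)
      (h.sub_smul_mem hp hy hpy _) (h.sub_smul_mem_perpPair hp hpq hpy)
      (by simpa [hA p] using hApy)
      (h.sub_smul_mem hq hz hqz _) (hsw (h.sub_smul_mem_perpPair hq hqp hqz))
      (by simpa [hA q] using hAqz)
    rw [mem_perpPair] at hwU
    exact (hedge hp hw hwU.1 hpw).trans (hedge hq hw hwU.2 hqw).symm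
  have hall : ∀ {p q y z : V}, p ∈ S → q ∈ S → y ∈ S → z ∈ S →
      φ p y = 0 → A p y ≠ 0 → φ q z = 0 → A q z ≠ 0 → c p = c q := by
    intro p q y z hp hq hy hz hpy hApy hqz hAqz
    by_cases hpq : φ p q = 0
    swap
    · exact hnonperp hp hq hy hz hpq hpy hApy hqz hAqz
    have hp0 : p ≠ 0 := by
      rintro rfl
      simp at hApy
    obtain ⟨p', hp', -, hpp⟩ := h.isSeparating_top p hp trivial hp0
    set a := φ p' q / φ p' p with ha
    -- If `q` is a multiple of `p`, then `y` itself is a common neighbour.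
    by_cases hq0 : q - a • p = 0
    · rw [sub_eq_zero] at hq0
      have haA : a ≠ 0 := by
        intro h0
        rw [hq0, h0] at hAqz
        simp at hAqz
      have hqy : φ q y = 0 := by simp [hq0, hpy]
      have hAqy : A q y ≠ 0 := by
        rw [hq0]
        simp [haA, hApy]
      exact (hedge hp hy hpy hApy).trans (hedge hq hy hqy hAqy).symm
    · have hqU := h.sub_smul_mem_perpPair hp hpp hpq
      obtain ⟨v, hv, hvU, hqv⟩ := hs hp hp' hpp _ (h.sub_smul_mem hp hq hpq a) hqU hq0
      have hqv' : φ q v ≠ 0 := by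
        simpa [(mem_perpPair.1 hvU).1] using hqv
      -- Taking `φ q` as second form gives a neighbour `w` of `p` not orthogonal to `q`, which
      -- reduces to `hnonperp`.
      obtain ⟨w, hw, hwU, hpw, hqw⟩ := h.exists_ne_zero_and_ne_zero (hs hp hp' hpp)
        (hc p hp p' hp' hpp) (f := A p) (g := φ q)
        (h.sub_smul_mem hp hy hpy _) (h.sub_smul_mem_perpPair hp hpp hpy)
        (by simpa [hA p] using hApy) hv hvU hqv'
      have hpw0 := (mem_perpPair.1 hwU).1
      have hAwp : A w p ≠ 0 := by
        rw [← hA.neg_eq p w]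
        exact neg_ne_zero.2 hpw
      exact (hedge hp hw hpw0 hpw).trans
        (hnonperp hw hq hp hz (h.ne_symm hqw) (h.symm hpw0) hAwp hqz hAqz)
  by_cases hgood : ∃ p ∈ S, ∃ y ∈ S, φ p y = 0 ∧ A p y ≠ 0
  · obtain ⟨p, hp, y, hy, hpy, hApy⟩ := hgood
    refine ⟨c p, fun x hx z hz hxz => ?_⟩
    by_cases hAxz : A x z = 0
    · rw [hAB x hx z hz hxz hAxz, hAxz, mul_zero]
    · rw [hall hp hx hy hz hpy hApy hxz hAxz]
      exact hcp x hx z hz hxz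
  · push Not at hgood
    exact ⟨0, fun x hx z hz hxz => by simpa using hAB x hx z hz hxz (hgood x hx z hz hxz)⟩

end IsPolarSpace

/-! ### Minimality of polar line Grassmann codes -/

theorem update_pair_zero {M : Type*} (a b c : M) :
    Function.update ![a, b] 0 c = ![c, b] := by
  ext i
  fin_cases i <;> rfl

theorem update_pair_one {M : Type*} (a b c : M) :
    Function.update ![a, b] 1 c = ![a, c] := by
  ext i
  fin_cases i <;> rfl

/-- The alternating bilinear form on `V` that corresponds to a linear form on `⋀² V`. -/
def wedgeForm (ξ : Module.Dual F (⋀[F]^2 V)) : LinearMap.BilinForm F V :=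
  LinearMap.mk₂ F (fun x y => ξ (exteriorPower.ιMulti F 2 ![x, y]))
    (fun x x' y => by
      have := (exteriorPower.ιMulti F 2).map_update_add ![0, y] 0 x x'
      simp only [update_pair_zero] at this
      rw [this, map_add])
    (fun a x y => by
      have := (exteriorPower.ιMulti F 2).map_update_smul ![0, y] 0 a x
      simp only [update_pair_zero] at this
      rw [this, map_smul])
    (fun x y y' => by
      have := (exteriorPower.ιMulti F 2).map_update_add ![x, 0] 1 y y'
      simp only [update_pair_one] at this
      rw [this, map_add])
    (fun a x y => by
      have := (exteriorPower.ιMulti F 2).map_update_smul ![x, 0] 1 a y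
      simp only [update_pair_one] at this
      rw [this, map_smul])

theorem wedgeForm_apply (ξ : Module.Dual F (⋀[F]^2 V)) (x y : V) :
    wedgeForm ξ x y = ξ (exteriorPower.ιMulti F 2 ![x, y]) := rfl

theorem wedgeForm_isAlt (ξ : Module.Dual F (⋀[F]^2 V)) : (wedgeForm ξ).IsAlt := by
  intro x
  rw [wedgeForm_apply, AlternatingMap.map_eq_zero_of_eq _ _ (i := 0) (j := 1) rfl (by decide),
    map_zero]

theorem IsPolarSpace.isMinimalCode {φ : V →ₛₗ[σ] V →ₗ[F] F} {S : Set V}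
    (h : IsPolarSpace φ S)
    (hc : ∀ p ∈ S, ∀ q ∈ S, φ p q ≠ 0 → HasCommonPerp φ S (perpPair φ p q))
    {T : Set (Submodule F V)}
    (hT : ∀ x y, Submodule.span F {x, y} ∈ T ↔ x ∈ S ∧ y ∈ S ∧ φ x y = 0) :
    IsMinimalCode (polarGrassmannCode 2 T) := by
  rintro _ ⟨ξ, rfl⟩ _ ⟨η, rfl⟩ hsupp
  have hpair : ∀ v : Fin 2 → V, v = ![v 0, v 1] := fun v => by
    ext i
    fin_cases i <;> rfl
  have hrange : ∀ v : Fin 2 → V, Set.range v = {v 0, v 1} := fun v => by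
    conv_lhs => rw [hpair v]
    simp [Set.pair_comm]
  obtain ⟨c, hcAB⟩ := h.exists_eq_mul hc (wedgeForm_isAlt ξ) (wedgeForm_isAlt η) (by
    intro x hx y hy hxy hξ
    by_contra hη
    have hne : exteriorPower.ιMulti F 2 ![x, y] ≠ 0 := by
      intro h0
      rw [wedgeForm_apply, h0, map_zero] at hη
      exact hη rfl
    have hli : LinearIndependent F ![x, y] := by
      by_contra hli
      exact hne (AlternatingMap.map_linearDependent _ _ hli)
    let P : ℙ F (⋀[F]^2 V) := Projectivization.mk F _ hne
    have hP : P ∈ grassmannImage 2 T :=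
      ⟨![x, y], hli, by rw [hrange]; exact (hT x y).2 ⟨hx, hy, hxy⟩,
        Projectivization.submodule_mk _ hne⟩
    -- The chosen representative differs by a unit, so zeros are unaffected.
    obtain ⟨a, ha⟩ := Projectivization.exists_smul_eq_mk_rep F _ hne
    refine hsupp (a := ⟨P, hP⟩) ?_ ?_
    · change η P.rep ≠ 0
      rw [← ha, Units.smul_def, map_smul]
      exact smul_ne_zero a.ne_zero hη
    · change ξ P.rep = 0
      rw [← ha, Units.smul_def, map_smul]
      exact (smul_eq_zero_of_right _ hξ))
  refine ⟨c, funext ?_⟩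
  rintro ⟨P, v, -, hvT, hPv⟩
  change η P.rep = c * ξ P.rep
  rw [hrange, hT] at hvT
  have hrep : P.rep ∈ Submodule.span F {exteriorPower.ιMulti F 2 v} := by
    rw [← hPv, Projectivization.submodule_eq]
    exact Submodule.mem_span_singleton_self _
  obtain ⟨a, ha⟩ := Submodule.mem_span_singleton.1 hrep
  have := hcAB _ hvT.1 _ hvT.2.1 hvT.2.2
  rw [wedgeForm_apply, wedgeForm_apply, ← hpair] at this
  rw [← ha, map_smul, map_smul, this, smul_eq_mul, smul_eq_mul]
  ring

theorem IsPolarSpace.isMinimalCode_of_hasIsotropic [FiniteDimensional F V]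
    {φ : V →ₛₗ[σ] V →ₗ[F] F} {S : Set V} (h : IsPolarSpace φ S) (h3 : HasIsotropic φ S ⊤ 3)
    {T : Set (Submodule F V)}
    (hT : ∀ x y, Submodule.span F {x, y} ∈ T ↔ x ∈ S ∧ y ∈ S ∧ φ x y = 0) :
    IsMinimalCode (polarGrassmannCode 2 T) :=
  h.isMinimalCode (fun p hp q _ hpq => h.hasCommonPerp_of_hasIsotropic (by
    simpa using h.hasIsotropic_inf_perpPair h3 hp trivial hpq)) hT

/-! ### Witt index and the three types of forms -/

theorem exists_mem_le_finrank_of_le_wittIndex [FiniteDimensional F V]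
    {T : Set (Submodule F V)} {k : ℕ} (hk : 0 < k) (hT : k ≤ wittIndex T) :
    ∃ X ∈ T, k ≤ Module.finrank F X := by
  have hne : ((fun X : Submodule F V => Module.finrank F X) '' T).Nonempty := by
    by_contra hne
    rw [Set.not_nonempty_iff_eq_empty] at hne
    -- The supremum of the empty set is 0, which `0 < k` rules out.
    rw [wittIndex, hne, csSup_empty] at hT
    exact absurd hT (by simpa using hk.ne')
  have hbdd : BddAbove ((fun X : Submodule F V => Module.finrank F X) '' T) := by
    refine ⟨Module.finrank F V, ?_⟩
    rintro _ ⟨X, -, rfl⟩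
    exact X.finrank_le
  obtain ⟨X, hX, hXe⟩ := Nat.sSup_mem hne hbdd
  exact ⟨X, hX, hT.trans_eq hXe.symm⟩

theorem span_pair_mem_totallyIsotropic_iff {φ : V →ₛₗ[σ] V →ₗ[F] F}
    (hφ : ∀ x y, φ x y = 0 → φ y x = 0) (x y : V) :
    Submodule.span F {x, y} ∈ totallyIsotropic φ ↔ φ x x = 0 ∧ φ y y = 0 ∧ φ x y = 0 := by
  have hx : x ∈ Submodule.span F {x, y} := Submodule.subset_span (by simp)
  have hy : y ∈ Submodule.span F {x, y} := Submodule.subset_span (by simp)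
  refine ⟨fun h => ⟨h x hx x hx, h y hy y hy, h x hx y hy⟩, ?_⟩
  rintro ⟨hxx, hyy, hxy⟩ u hu v hv
  obtain ⟨a, b, rfl⟩ := Submodule.mem_span_pair.1 hu
  obtain ⟨c, d, rfl⟩ := Submodule.mem_span_pair.1 hv
  simp [hxx, hyy, hxy, hφ x y hxy]

theorem LinearMap.BilinForm.IsAlt.isPolarSpace {φ : LinearMap.BilinForm F V} (hφ : φ.IsAlt)
    (hn : φ.Nondegenerate) : IsPolarSpace φ Set.univ where
  smul_mem _ _ _ := trivial
  add_mem _ _ _ := trivial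
  symm := fun {x y} hxy => hφ.isRefl x y hxy
  self _ := hφ _
  exists_add_smul_mem _ _ := ⟨0, trivial⟩
  exists_ne := fun {x} _ hx0 => by
    by_contra! h0
    exact hx0 (hn.1 x h0)

theorem QuadraticForm.isPolarSpace {Q : QuadraticForm F V}
    (hn : QuadraticMap.Nondegenerate (Q := Q)) :
    IsPolarSpace (QuadraticMap.polarBilin Q) {x | Q x = 0} where
  smul_mem a x hx := by
    have hx : Q x = 0 := hx
    simp [QuadraticMap.map_smul, hx]
  add_mem := fun {x y} hx hy hxy => by
    have hx : Q x = 0 := hx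
    have hy : Q y = 0 := hy
    rw [QuadraticMap.polarBilin_apply_apply] at hxy
    simp [QuadraticMap.map_add, hx, hy, hxy]
  symm := fun {x y} hxy => by
    rw [QuadraticMap.polarBilin_apply_apply] at hxy ⊢
    rwa [QuadraticMap.polar_comm]
  self := fun {x} hx => by
    have hx : Q x = 0 := hx
    simp [hx]
  exists_add_smul_mem := fun {x w} hx hxw => by
    have hx : Q x = 0 := hx
    rw [QuadraticMap.polarBilin_apply_apply, QuadraticMap.polar_comm] at hxw
    -- Q(w + cx) = Q(w) + c·polar(w,x) is linear in c, as `x` is singular.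
    refine ⟨-(Q w / QuadraticMap.polar Q w x), ?_⟩
    simp [QuadraticMap.map_add, QuadraticMap.map_smul, hx, QuadraticMap.polar_smul_right, hxw]
  exists_ne := fun {x} hx hx0 => by
    by_contra! h0
    have : x ∈ Q.radical := ⟨hx, LinearMap.ext h0⟩
    rw [hn.radical_eq_bot] at this
    exact hx0 (by simpa using this)

theorem span_pair_mem_totallySingular_iff (Q : QuadraticForm F V) (x y : V) :
    Submodule.span F {x, y} ∈ totallySingular Q ↔
      Q x = 0 ∧ Q y = 0 ∧ QuadraticMap.polarBilin Q x y = 0 := by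
  have hx : x ∈ Submodule.span F {x, y} := Submodule.subset_span (by simp)
  have hy : y ∈ Submodule.span F {x, y} := Submodule.subset_span (by simp)
  rw [QuadraticMap.polarBilin_apply_apply]
  constructor
  · intro h
    have h1 := h _ hx
    have h2 := h _ hy
    have h3 := h _ (Submodule.add_mem _ hx hy)
    exact ⟨h1, h2, by simp [QuadraticMap.polar, h1, h2, h3]⟩
  · rintro ⟨hx0, hy0, hxy⟩ u hu
    obtain ⟨a, b, rfl⟩ := Submodule.mem_span_pair.1 hu
    simp [QuadraticMap.map_add, QuadraticMap.map_smul, hx0, hy0, QuadraticMap.polar_smul_left,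
      QuadraticMap.polar_smul_right, hxy]

/-- The trace to the fixed field is onto once it is nonzero. Were it zero, t = 1 would give 2 = 0,
hence σ(a) = -a = a. -/
theorem exists_add_map_eq_of_ne_id (hσ : σ ≠ RingHom.id F) (hσ2 : ∀ a, σ (σ a) = a) {s : F}
    (hs : σ s = s) : ∃ t, t + σ t = s := by
  have hex : ∃ t, t + σ t ≠ 0 := by
    by_contra! h0
    have h2 : (1 : F) + 1 = 0 := by simpa using h0 1
    refine hσ (RingHom.ext fun a => ?_)
    rw [RingHom.id_apply]
    linear_combination h0 a - a * h2
  obtain ⟨t, ht⟩ := hex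
  refine ⟨s / (t + σ t) * t, ?_⟩
  rw [map_mul, map_div₀, map_add, hs, hσ2, add_comm (σ t) t]
  field_simp

theorem LinearMap.IsSymm.isPolarSpace {h : V →ₛₗ[σ] V →ₗ[F] F} (hσ : σ ≠ RingHom.id F)
    (hσ2 : ∀ a, σ (σ a) = a) (hs : h.IsSymm) (hn : h.Nondegenerate) :
    IsPolarSpace h {x | h x x = 0} where
  smul_mem a x hx := by
    have hx : h x x = 0 := hx
    simp [hx]
  add_mem := fun {x y} hx hy hxy => by
    have hx : h x x = 0 := hx
    have hy : h y y = 0 := hy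
    have hyx : h y x = 0 := by rw [← hs.eq, hxy, map_zero]
    simp [hx, hy, hxy, hyx]
  symm := fun {x y} hxy => by rw [← hs.eq, hxy, map_zero]
  self hx := hx
  exists_add_smul_mem := fun {x w} hx hxw => by
    have hx : h x x = 0 := hx
    obtain ⟨t, ht⟩ := exists_add_map_eq_of_ne_id hσ hσ2 (hs.eq w w)
    -- With this c the cross terms of h(w + cx, w + cx) sum to -(t + σ t) = -h(w,w).
    refine ⟨-(t / h w x), ?_⟩
    have hwx : h w x ≠ 0 := by
      rw [← hs.eq]
      simpa using hxw
    have h1 : h x w = σ (h w x) := (hs.eq w x).symm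
    have h2 : σ (h w x) ≠ 0 := by simpa using hwx
    simp only [Set.mem_ofPred_eq, map_add, LinearMap.add_apply, map_smulₛₗ,
      LinearMap.smul_apply, smul_eq_mul, hx, map_neg, map_div₀, h1, RingHom.id_apply]
    field_simp
    linear_combination -(σ (h w x) * h w x) * ht
  exists_ne := fun {x} _ hx0 => by
    by_contra! h0
    exact hx0 (hn.1 x h0)

end PolarSpace

theorem proposition4p3 {F V : Type*} [Field F] [Finite F] (hF : Nat.card F ≠ 2)
    [AddCommGroup V] [Module F V] [FiniteDimensional F V] :
    -- line symplectic Grassmann codes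
    (∀ φ : LinearMap.BilinForm F V, φ.IsAlt → φ.Nondegenerate →
      2 ≤ wittIndex (totallyIsotropic φ) →
      IsMinimalCode (polarGrassmannCode 2 (totallyIsotropic φ))) ∧
    -- line orthogonal Grassmann codes
    (∀ Q : QuadraticForm F V, QuadraticMap.Nondegenerate (Q := Q) →
      3 ≤ wittIndex (totallySingular Q) →
      IsMinimalCode (polarGrassmannCode 2 (totallySingular Q))) ∧
    -- line hermitian Grassmann codes
    (∀ σ : F →+* F, σ ≠ RingHom.id F → (∀ a, σ (σ a) = a) →
      ∀ h : V →ₛₗ[σ] V →ₗ[F] F, h.IsSymm → h.Nondegenerate →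
      3 ≤ wittIndex (totallyIsotropic h) →
      IsMinimalCode (polarGrassmannCode 2 (totallyIsotropic h))) := by
  refine ⟨fun φ hφ hn _ => ?_, fun Q hn hQ => ?_, fun σ hσ hσ2 h hs hn h3 => ?_⟩
  -- Every vector is singular, so the first alternative of `HasCommonPerp` always holds.
  · refine (hφ.isPolarSpace hn).isMinimalCode
      (fun p _ q _ _ y _ _ z _ _ _ => Or.inl fun _ => trivial) fun x y => ?_
    rw [span_pair_mem_totallyIsotropic_iff fun x y hxy => hφ.isRefl x y hxy]
    simp [hφ x, hφ y]
  · obtain ⟨X, hX, hXk⟩ := exists_mem_le_finrank_of_le_wittIndex (by norm_num) hQ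
    refine (QuadraticForm.isPolarSpace hn).isMinimalCode_of_hasIsotropic
      ⟨X, le_top, hX, fun x hx y hy => ?_, hXk⟩ (span_pair_mem_totallySingular_iff Q)
    simp [QuadraticMap.polar, hX x hx, hX y hy, hX _ (X.add_mem hx hy)]
  · obtain ⟨X, hX, hXk⟩ := exists_mem_le_finrank_of_le_wittIndex (by norm_num) h3
    exact (hs.isPolarSpace hσ hσ2 hn).isMinimalCode_of_hasIsotropic
      ⟨X, le_top, fun x hx => hX x hx x hx, hX, hXk⟩
      (span_pair_mem_totallyIsotropic_iff fun x y hxy => by rw [← hs.eq, hxy, map_zero])
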